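/- Let $n,m\ge 0$ be integers. A port-Hamiltonian (pH) descriptor system is given by real matrices $E,J,R\in\mathbb R^{n\times n}$, $G,P\in\mathbb R^{n\times m}$, $S,N\in\mathbb R^{m\times m}$, through $$E\dot x=(J-R)x+(G-P)u,\qquad y=(G+P)^Tx+(S+N)u,$$ such that $$E=E^T\ge 0,\qquad \begin{bmatrix}J&G\\-G^T&N\end{bmatrix}=-\begin{bmatrix}J&G\\-G^T&N\end{bmatrix}^T,\qquad \begin{bmatrix}R&P\\P^T&S\end{bmatrix}=\begin{bmatrix}R&P\\P^T&S\end{bmatrix}^T\ge 0 .$$ For $F\in\mathbb R^{m\times n}$ the state feedback $u=Fx+v$ leads to the closed-loop system with coefficients $(E,\tilde J,\tilde R,\tilde G,\tilde P,S,N)$, where $$\tilde J=J+\tfrac12\big[(G-P)F-F^T(G-P)^T\big],\qquad \tilde R=R-\tfrac12\big[(G-P)F+F^T(G-P)^T\big],$$ $$\tilde G=G+\tfrac12F^T(S+N)^T,\qquad \tilde P=P+\tfrac12F^T(S+N)^T .$$ For a real matrix $M$ let $\mathcal S_\infty(M)$ and $\mathcal R(M)$ denote matrices with orthonormal columns that span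 the right nullspace and the range of $M$, respectively, and let $M^{(+)}$ be the Moore–Penrose inverse of $M$. A square pencil $sE-A$ is regular if $\det(sE-A)$ is not identically zero in $s\in\mathbb C$; its finite eigenvalues are then the zeros of $\det(sE-A)$ in $\mathbb C$. A regular pencil has index at most $k$ if all its Jordan blocks at the eigenvalue $\infty$ have size at most $k$, that is, if there are nonsingular matrices $T,U$ with $T(sE-A)U=s\begin{bmatrix}I&0\\0&Z\end{bmatrix}-\begin{bmatrix}C&0\\0&I\end{bmatrix}$ and $Z^k=0$. **Theorem.** Let $(E,J,R,G,P,S,N)$ be a pH descriptor system. For any choice of the matrices $\mathcal S_\infty(E)$, $\mathcal R(S)$, $\mathcal S_\infty(S+N)$, set $$B_1=(G-P)(S+N)^{(+)}\mathcal R(S),\qquad B_3=(G-P)\,\mathcal S_\infty(S+N).$$ There exists $F\in\mathbb R^{m\times n}$ such that the closed-loop system $(E,\tilde J,\tilde R,\tilde G,\tilde P,S,N)$ is port-Hamiltonian and the pencil $sE-(\tilde J-\tilde R)$ is regular, has index at most one, and has all its finite eigenvalues in the open left half plane $\{s\in\mathbb C:\operatorname{Re}s<0\}$, if and only if both $$\operatorname{rank}\begin{bmatrix}sE-(J-R)&B_1&B_3\end{bmatrix}=n\quad\text{for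 all } s\in\mathbb C \text{ with } \operatorname{Re}s=0$$ and $$\operatorname{rank}\begin{bmatrix}E&(J-R)\,\mathcal S_\infty(E)&B_1&B_3\end{bmatrix}=n .$$ -/

import Mathlib

open Matrix

noncomputable section

/-- The coefficient matrices of a linear time-invariant descriptor system
`E x' = (J - R) x + (G - P) u`, `y = (G + P)ᵀ x + (S + N) u`
with `n` states and `m` inputs and outputs. -/
structure DescriptorSystem (n m : ℕ) where
  E : Matrix (Fin n) (Fin n) ℝ
  J : Matrix (Fin n) (Fin n) ℝ
  R : Matrix (Fin n) (Fin n) ℝ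
  G : Matrix (Fin n) (Fin m) ℝ
  P : Matrix (Fin n) (Fin m) ℝ
  S : Matrix (Fin m) (Fin m) ℝ
  N : Matrix (Fin m) (Fin m) ℝ

namespace DescriptorSystem

variable {n m : ℕ}

/-- The system is port-Hamiltonian: `E = Eᵀ ≥ 0`, the structure matrix `[J, G; -Gᵀ, N]` is
skew-symmetric and the dissipation matrix `[R, P; Pᵀ, S]` is symmetric positive semidefinite. -/
structure IsPortHamiltonian (sys : DescriptorSystem n m) : Prop where
  E_posSemidef : sys.E.PosSemidef
  structure_skew :
    fromBlocks sys.J sys.G (-sys.Gᵀ) sys.N = -(fromBlocks sys.J sys.G (-sys.Gᵀ) sys.N)ᵀ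
  dissipation_posSemidef : (fromBlocks sys.R sys.P sys.Pᵀ sys.S).PosSemidef

/-- The closed-loop system obtained from the state feedback `u = F x + v`, with its coefficients
split into the tilde matrices `J̃`, `R̃`, `G̃`, `P̃` (while `E`, `S`, `N` are unchanged). -/
def closedLoop (sys : DescriptorSystem n m) (F : Matrix (Fin m) (Fin n) ℝ) :
    DescriptorSystem n m where
  E := sys.E
  J := sys.J + (1 / 2 : ℝ) • ((sys.G - sys.P) * F - Fᵀ * (sys.G - sys.P)ᵀ)
  R := sys.R - (1 / 2 : ℝ) • ((sys.G - sys.P) * F + Fᵀ * (sys.G - sys.P)ᵀ)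
  G := sys.G + (1 / 2 : ℝ) • (Fᵀ * (sys.S + sys.N)ᵀ)
  P := sys.P + (1 / 2 : ℝ) • (Fᵀ * (sys.S + sys.N)ᵀ)
  S := sys.S
  N := sys.N

end DescriptorSystem

/-- A real matrix regarded as a complex one. -/
def complexify {p q : ℕ} (M : Matrix (Fin p) (Fin q) ℝ) : Matrix (Fin p) (Fin q) ℂ :=
  M.map Complex.ofReal

/-- The square matrix pencil `s E - A` at the complex number `s`. -/
def pencil {n : ℕ} (E A : Matrix (Fin n) (Fin n) ℝ) (s : ℂ) : Matrix (Fin n) (Fin n) ℂ :=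
  s • complexify E - complexify A

/-- The pencil `s E - A` is regular: `det (s E - A)` does not vanish identically. -/
def IsRegularPencil {n : ℕ} (E A : Matrix (Fin n) (Fin n) ℝ) : Prop :=
  ∃ s : ℂ, (pencil E A s).det ≠ 0

/-- `s` is a finite eigenvalue of the (regular) pencil `s E - A`. -/
def IsFiniteEigenvalue {n : ℕ} (E A : Matrix (Fin n) (Fin n) ℝ) (s : ℂ) : Prop :=
  (pencil E A s).det = 0

/-- The (regular) pencil `s E - A` has index at most `k`: it is equivalent, under multiplication by
nonsingular matrices from the left and from the right, to a Weierstrass form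
`s [I, 0; 0, Z] - [C, 0; 0, I]` with `Z ^ k = 0`, which says that `Z` is nilpotent and that its
Jordan blocks, the blocks of the pencil at the eigenvalue `∞`, have size at most `k`. -/
def HasIndexAtMost {n : ℕ} (E A : Matrix (Fin n) (Fin n) ℝ) (k : ℕ) : Prop :=
  ∃ (a b : ℕ) (e : Fin a ⊕ Fin b ≃ Fin n) (T U : Matrix (Fin n) (Fin n) ℝ)
    (C : Matrix (Fin a) (Fin a) ℝ) (Z : Matrix (Fin b) (Fin b) ℝ),
    IsUnit T.det ∧ IsUnit U.det ∧
    (T * E * U).submatrix e e = fromBlocks 1 0 0 Z ∧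
    (T * A * U).submatrix e e = fromBlocks C 0 0 1 ∧
    Z ^ k = 0

/-- `Q` is a matrix `S_∞(M)`: its columns are orthonormal and span the right nullspace of `M`. -/
structure IsNullspaceMatrix {p q k : ℕ} (M : Matrix (Fin p) (Fin q) ℝ)
    (Q : Matrix (Fin q) (Fin k) ℝ) : Prop where
  orthonormal : Qᵀ * Q = 1
  span_eq : Submodule.span ℝ (Set.range Q.col) = LinearMap.ker M.mulVecLin

/-- `Q` is a matrix `𝓡(M)`: its columns are orthonormal and span the range of `M`. -/
structure IsRangeMatrix {p q k : ℕ} (M : Matrix (Fin p) (Fin q) ℝ)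
    (Q : Matrix (Fin p) (Fin k) ℝ) : Prop where
  orthonormal : Qᵀ * Q = 1
  span_eq : Submodule.span ℝ (Set.range Q.col) = LinearMap.range M.mulVecLin

theorem exists_orthonormal_columns {p : ℕ} (V : Submodule ℝ (Fin p → ℝ)) :
    ∃ (k : ℕ) (Q : Matrix (Fin p) (Fin k) ℝ), Qᵀ * Q = 1 ∧
      Submodule.span ℝ (Set.range Q.col) = V := by
  let L := (WithLp.linearEquiv 2 ℝ (Fin p → ℝ)).toLinearMap
  let W : Submodule ℝ (EuclideanSpace ℝ (Fin p)) := V.comap L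
  let b := stdOrthonormalBasis ℝ W
  refine ⟨_, Matrix.of fun i j => (b j : EuclideanSpace ℝ (Fin p)) i, ?_, ?_⟩
  · ext i j
    have h := orthonormal_iff_ite.mp b.orthonormal i j
    rw [Submodule.coe_inner, PiLp.inner_apply] at h
    rw [Matrix.mul_apply, Matrix.one_apply, ← h]
    exact Finset.sum_congr rfl fun x _ => by simp [mul_comm]
  · have h1 : Set.range (Matrix.of fun i j => (b j : EuclideanSpace ℝ (Fin p)) i).col
        = (L ∘ₗ W.subtype) '' Set.range b := by
      rw [← Set.range_comp]
      rfl
    have hb : Submodule.span ℝ (Set.range b) = ⊤ := by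
      rw [← b.coe_toBasis]; exact b.toBasis.span_eq
    rw [h1, ← Submodule.map_span, hb, Submodule.map_comp, Submodule.map_subtype_top]
    exact Submodule.map_comap_eq_of_surjective (WithLp.linearEquiv 2 ℝ (Fin p → ℝ)).surjective V

theorem exists_isNullspaceMatrix {p q : ℕ} (M : Matrix (Fin p) (Fin q) ℝ) :
    ∃ (k : ℕ) (Q : Matrix (Fin q) (Fin k) ℝ), IsNullspaceMatrix M Q := by
  obtain ⟨k, Q, h1, h2⟩ := exists_orthonormal_columns (LinearMap.ker M.mulVecLin)
  exact ⟨k, Q, h1, h2⟩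

theorem exists_isRangeMatrix {p q : ℕ} (M : Matrix (Fin p) (Fin q) ℝ) :
    ∃ (k : ℕ) (Q : Matrix (Fin p) (Fin k) ℝ), IsRangeMatrix M Q := by
  obtain ⟨k, Q, h1, h2⟩ := exists_orthonormal_columns (LinearMap.range M.mulVecLin)
  exact ⟨k, Q, h1, h2⟩

/-- The four Penrose equations. -/
structure IsMoorePenrose {p q : ℕ} (M : Matrix (Fin p) (Fin q) ℝ)
    (X : Matrix (Fin q) (Fin p) ℝ) : Prop where
  mul_mul_left : M * X * M = M
  mul_mul_right : X * M * X = X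
  symm_left : (M * X)ᵀ = M * X
  symm_right : (X * M)ᵀ = X * M

theorem IsMoorePenrose.unique {p q : ℕ} {M : Matrix (Fin p) (Fin q) ℝ}
    {X Y : Matrix (Fin q) (Fin p) ℝ} (hX : IsMoorePenrose M X) (hY : IsMoorePenrose M Y) :
    X = Y := by
  have h1 : M * X = M * Y := by
    have : M * X * (M * Y) = M * Y := by rw [← Matrix.mul_assoc, hX.mul_mul_left]
    rw [← this, ← hX.symm_left, ← hY.symm_left, ← Matrix.transpose_mul, ← Matrix.mul_assoc,
      hY.mul_mul_left]
  have h2 : X * M = Y * M := by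
    have : X * M * (Y * M) = X * M := by
      rw [Matrix.mul_assoc, ← Matrix.mul_assoc M, hY.mul_mul_left]
    rw [← this, ← hX.symm_right, ← hY.symm_right, ← Matrix.transpose_mul, Matrix.mul_assoc,
      ← Matrix.mul_assoc M, hX.mul_mul_left]
  rw [← hX.mul_mul_right, h2, Matrix.mul_assoc, h1, ← Matrix.mul_assoc, hY.mul_mul_right]

theorem exists_isMoorePenrose {p q : ℕ} (M : Matrix (Fin p) (Fin q) ℝ) :
    ∃ X, IsMoorePenrose M X := by
  have hH : (Mᵀ * M).IsHermitian := by
    rw [← Matrix.conjTranspose_eq_transpose_of_trivial]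
    exact Matrix.isHermitian_conjTranspose_mul_self M
  obtain ⟨K, hK, h1, h2, h3⟩ : ∃ K : Matrix (Fin q) (Fin q) ℝ, Kᵀ = K ∧
      Mᵀ * M * K * (Mᵀ * M) = Mᵀ * M ∧ K * (Mᵀ * M) * K = K ∧
      (K * (Mᵀ * M))ᵀ = K * (Mᵀ * M) := by
    obtain ⟨V, d, hV, hM⟩ : ∃ (V : Matrix (Fin q) (Fin q) ℝ) (d : Fin q → ℝ),
        Vᵀ * V = 1 ∧ Mᵀ * M = V * diagonal d * Vᵀ := by
      refine ⟨hH.eigenvectorUnitary, hH.eigenvalues, ?_, ?_⟩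
      · have := Unitary.coe_star_mul_self hH.eigenvectorUnitary
        rwa [Matrix.star_eq_conjTranspose, Matrix.conjTranspose_eq_transpose_of_trivial] at this
      · conv_lhs => rw [hH.spectral_theorem, Unitary.conjStarAlgAut_apply]
        rw [Matrix.star_eq_conjTranspose, Matrix.conjTranspose_eq_transpose_of_trivial]
        rfl
    have key : ∀ c c' : Fin q → ℝ, V * diagonal c * Vᵀ * (V * diagonal c' * Vᵀ)
        = V * diagonal (fun i => c i * c' i) * Vᵀ := fun c c' => by
      calc V * diagonal c * Vᵀ * (V * diagonal c' * Vᵀ)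
          = V * diagonal c * (Vᵀ * V) * diagonal c' * Vᵀ := by simp only [Matrix.mul_assoc]
        _ = _ := by
          rw [hV, Matrix.mul_one, Matrix.mul_assoc V, Matrix.diagonal_mul_diagonal]
    have ht : ∀ c : Fin q → ℝ, (V * diagonal c * Vᵀ)ᵀ = V * diagonal c * Vᵀ := fun c => by
      simp [Matrix.transpose_mul, Matrix.mul_assoc]
    refine ⟨V * diagonal (fun i => (d i)⁻¹) * Vᵀ, ht _, ?_, ?_, ?_⟩
    · simp only [hM, key, mul_inv_mul_cancel]
    · have hd : (fun i => (d i)⁻¹ * d i * (d i)⁻¹) = fun i => (d i)⁻¹ := by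
        funext i
        by_cases h : d i = 0 <;> simp [h]
      simp only [hM, key, hd]
    · simp only [hM, key, ht]
  refine ⟨K * Mᵀ, ?_, ?_, ?_, ?_⟩
  · have h0 : (M * K * (Mᵀ * M) - M)ᵀ * (M * K * (Mᵀ * M) - M) = 0 := by
      have : (M * K * (Mᵀ * M) - M)ᵀ * M = 0 := by
        rw [Matrix.transpose_sub, Matrix.sub_mul, sub_eq_zero]
        simp only [Matrix.transpose_mul, Matrix.transpose_transpose, hK]
        simpa only [Matrix.mul_assoc] using h1
      rw [Matrix.mul_assoc M K] at this ⊢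
      rw [Matrix.mul_sub, this, ← Matrix.mul_assoc _ M, this]
      simp
    rw [← Matrix.conjTranspose_eq_transpose_of_trivial,
      Matrix.conjTranspose_mul_self_eq_zero, sub_eq_zero] at h0
    simpa only [Matrix.mul_assoc] using h0
  · rw [Matrix.mul_assoc K Mᵀ M, ← Matrix.mul_assoc, h2]
  · simp only [Matrix.transpose_mul, Matrix.transpose_transpose, hK, Matrix.mul_assoc]
  · rw [Matrix.mul_assoc, h3]

/-- The Moore-Penrose inverse of a real matrix, the unique solution of the Penrose equations. -/
def moorePenrose {p q : ℕ} (M : Matrix (Fin p) (Fin q) ℝ) : Matrix (Fin q) (Fin p) ℝ :=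
  (exists_isMoorePenrose M).choose

theorem moorePenrose_spec {p q : ℕ} (M : Matrix (Fin p) (Fin q) ℝ) :
    IsMoorePenrose M (moorePenrose M) :=
  (exists_isMoorePenrose M).choose_spec

end

/-! ### Ranks and column spans -/

/-! Write `B = G - P`, `D = S + N`, and read each rank condition as the vanishing of a left kernel.
Necessity: positive semidefiniteness of the dissipation matrix forces `P` to vanish on `ker S`,
before and after feedback, so `D * F` has its range in that of `S`. Hence `F = D⁺ 𝓡(S) F₁ + 𝓢∞(D)
F₃` (`exists_feedback_factorization`), and a left vector that kills `B₁` and `B₃` kills `B * F`. A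
violation of either rank condition thus survives every admissible feedback. Sufficiency:
`exists_dissipative_feedback` gives an admissible `F` for which `xᵀ R̃ x = 0` forces `x` to kill
`B₁` and `B₃`. For `Re s ≥ 0` the energy balance of a left null vector of the closed-loop pencil
gives zero dissipation, and `x E = 0` when `Re s > 0` (`eq_zero_of_vecMul_pencil`). Such a vector
does not see the feedback, so the rank conditions make it zero. The index is handled by the same
argument on `ker E`, through a left-kernel criterion for index at most one. -/

theorem rank_eq_iff_forall_vecMul {K ι : Type*} [Field K] [Fintype ι] {n : ℕ}
    (M : Matrix (Fin n) ι K) : M.rank = n ↔ ∀ x, x ᵥ* M = 0 → x = 0 := by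
  have h1 : (∀ x, x ᵥ* M = 0 → x = 0) ↔ LinearIndependent K M.row := by
    rw [← Matrix.vecMul_injective_iff]
    exact (injective_iff_map_eq_zero M.vecMulLinear).symm
  rw [h1, linearIndependent_iff_card_eq_finrank_span, Matrix.rank_eq_finrank_span_row,
    Fintype.card_fin, eq_comm]
  rfl

theorem elim_eq_zero_iff {α β γ : Type*} [Zero γ] (f : α → γ) (g : β → γ) :
    Sum.elim f g = 0 ↔ f = 0 ∧ g = 0 := by
  rw [← Sum.elim_zero_zero, Sum.elim_eq_iff]

theorem exists_eq_mul_of_span_col_le {p q k : ℕ} {Q : Matrix (Fin p) (Fin k) ℝ}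
    {M : Matrix (Fin p) (Fin q) ℝ}
    (h : ∀ j, M.col j ∈ Submodule.span ℝ (Set.range Q.col)) :
    ∃ X : Matrix (Fin k) (Fin q) ℝ, M = Q * X := by
  rw [← Matrix.range_mulVecLin] at h
  choose X hX using h
  refine ⟨(Matrix.of X)ᵀ, ?_⟩
  ext i j
  exact (congrFun (hX j) i).symm

theorem IsNullspaceMatrix.mul_eq_zero {p q k : ℕ} {M : Matrix (Fin p) (Fin q) ℝ}
    {Q : Matrix (Fin q) (Fin k) ℝ} (h : IsNullspaceMatrix M Q) : M * Q = 0 := by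
  ext i j
  have : Q.col j ∈ LinearMap.ker M.mulVecLin := h.span_eq ▸ Submodule.subset_span ⟨j, rfl⟩
  exact congrFun (show M *ᵥ Q.col j = 0 from this) i

theorem IsNullspaceMatrix.exists_eq_mul {p q k l : ℕ} {M : Matrix (Fin p) (Fin q) ℝ}
    {Q : Matrix (Fin q) (Fin k) ℝ} (h : IsNullspaceMatrix M Q) {W : Matrix (Fin q) (Fin l) ℝ}
    (hW : M * W = 0) : ∃ X : Matrix (Fin k) (Fin l) ℝ, W = Q * X := by
  refine exists_eq_mul_of_span_col_le fun j => ?_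
  rw [h.span_eq, LinearMap.mem_ker]
  ext i
  exact congrFun (congrFun hW i) j

theorem IsNullspaceMatrix.exists_eq_mulVec {p q k : ℕ} {M : Matrix (Fin p) (Fin q) ℝ}
    {Q : Matrix (Fin q) (Fin k) ℝ} (h : IsNullspaceMatrix M Q) {x : Fin q → ℝ}
    (hx : M *ᵥ x = 0) : ∃ c, x = Q *ᵥ c := by
  have hx : x ∈ LinearMap.ker M.mulVecLin := hx
  rw [← h.span_eq, ← Matrix.range_mulVecLin] at hx
  obtain ⟨c, hc⟩ := hx
  exact ⟨c, hc.symm⟩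

theorem IsRangeMatrix.exists_eq_mul {p q k : ℕ} {M : Matrix (Fin p) (Fin q) ℝ}
    {Q : Matrix (Fin p) (Fin k) ℝ} (h : IsRangeMatrix M Q) :
    ∃ X : Matrix (Fin q) (Fin k) ℝ, Q = M * X := by
  refine exists_eq_mul_of_span_col_le fun j => ?_
  rw [← Matrix.range_mulVecLin, ← h.span_eq]
  exact Submodule.subset_span ⟨j, rfl⟩

theorem IsRangeMatrix.exists_mul_eq {p q k : ℕ} {M : Matrix (Fin p) (Fin q) ℝ}
    {Q : Matrix (Fin p) (Fin k) ℝ} (h : IsRangeMatrix M Q) :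
    ∃ X : Matrix (Fin k) (Fin q) ℝ, M = Q * X := by
  refine exists_eq_mul_of_span_col_le fun j => ?_
  rw [h.span_eq, Matrix.range_mulVecLin]
  exact Submodule.subset_span ⟨j, rfl⟩

theorem IsRangeMatrix.mul_transpose_mul {p q k : ℕ} {M : Matrix (Fin p) (Fin q) ℝ}
    {Q : Matrix (Fin p) (Fin k) ℝ} (h : IsRangeMatrix M Q) : Q * Qᵀ * M = M := by
  obtain ⟨X, rfl⟩ := h.exists_mul_eq
  rw [← Matrix.mul_assoc, Matrix.mul_assoc Q, h.orthonormal, Matrix.mul_one]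

/-! ### Complexified matrices and pencils -/

theorem complexify_add {p q : ℕ} (M M' : Matrix (Fin p) (Fin q) ℝ) :
    complexify (M + M') = complexify M + complexify M' :=
  Matrix.map_add _ Complex.ofReal_add M M'

theorem pencil_add {n : ℕ} (E A A' : Matrix (Fin n) (Fin n) ℝ) (s : ℂ) :
    pencil E (A + A') s = pencil E A s - complexify A' := by
  rw [pencil, pencil, complexify_add, sub_sub]

theorem re_vecMul_complexify {p q : ℕ} (M : Matrix (Fin p) (Fin q) ℝ) (x : Fin p → ℂ) (j : Fin q) :
    ((x ᵥ* complexify M) j).re = ((fun i => (x i).re) ᵥ* M) j := by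
  simp [Matrix.vecMul, dotProduct, complexify]

theorem im_vecMul_complexify {p q : ℕ} (M : Matrix (Fin p) (Fin q) ℝ) (x : Fin p → ℂ) (j : Fin q) :
    ((x ᵥ* complexify M) j).im = ((fun i => (x i).im) ᵥ* M) j := by
  simp [Matrix.vecMul, dotProduct, complexify]

/-- Passing to real and imaginary parts lets complex left null vectors be tested against real
quadratic forms. -/
theorem vecMul_complexify_eq_zero_iff {p q : ℕ} (M : Matrix (Fin p) (Fin q) ℝ) (x : Fin p → ℂ) :
    x ᵥ* complexify M = 0 ↔
      (fun i => (x i).re) ᵥ* M = 0 ∧ (fun i => (x i).im) ᵥ* M = 0 := by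
  simp only [funext_iff, Complex.ext_iff, re_vecMul_complexify, im_vecMul_complexify,
    Pi.zero_apply, Complex.zero_re, Complex.zero_im, forall_and]

theorem vecMul_pencil_eq_zero_iff {n : ℕ} (E A : Matrix (Fin n) (Fin n) ℝ) (s : ℂ)
    (x : Fin n → ℂ) : x ᵥ* pencil E A s = 0 ↔
      s.re • ((fun i => (x i).re) ᵥ* E) - s.im • ((fun i => (x i).im) ᵥ* E)
        = (fun i => (x i).re) ᵥ* A ∧
      s.re • ((fun i => (x i).im) ᵥ* E) + s.im • ((fun i => (x i).re) ᵥ* E)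
        = (fun i => (x i).im) ᵥ* A := by
  simp only [funext_iff, pencil, Matrix.vecMul_sub, Matrix.vecMul_smul, Complex.ext_iff,
    Pi.sub_apply, Pi.add_apply, Pi.smul_apply, smul_eq_mul, Complex.mul_re, Complex.mul_im,
    re_vecMul_complexify, im_vecMul_complexify, forall_and, sub_eq_zero]

theorem det_pencil_ne_zero_iff {n : ℕ} (E A : Matrix (Fin n) (Fin n) ℝ) (s : ℂ) :
    (pencil E A s).det ≠ 0 ↔ ∀ x, x ᵥ* pencil E A s = 0 → x = 0 := by
  rw [ne_eq, ← Matrix.exists_vecMul_eq_zero_iff]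
  push Not
  exact forall_congr' fun x => not_imp_not

/-! ### Index at most one -/

/-- In Weierstrass coordinates with `Z = 0`, `x E = 0` kills the first component of `x T⁻¹`. The
second block of columns of `U` lies in `ker E`, where `A` acts as the identity block, so `x (A Q) =
0` kills the second. -/
theorem HasIndexAtMost.eq_zero_of_vecMul {n k : ℕ} {E A : Matrix (Fin n) (Fin n) ℝ}
    (h : HasIndexAtMost E A 1) {Q : Matrix (Fin n) (Fin k) ℝ} (hQ : IsNullspaceMatrix E Q)
    {x : Fin n → ℝ} (hE : x ᵥ* E = 0) (hA : x ᵥ* (A * Q) = 0) : x = 0 := by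
  obtain ⟨a, b, e, T, U, C, Z, hT, hU, hTE, hTA, hZ⟩ := h
  rw [pow_one] at hZ
  subst hZ
  set y : Fin n → ℝ := x ᵥ* T⁻¹ with hy
  have hyT : y ᵥ* T = x := by
    rw [hy, Matrix.vecMul_vecMul, Matrix.nonsing_inv_mul _ hT, Matrix.vecMul_one]
  have key : ∀ M : Matrix (Fin n) (Fin n) ℝ,
      (y ∘ e) ᵥ* (T * M * U).submatrix e e = (x ᵥ* (M * U)) ∘ e := fun M => by
    rw [Matrix.submatrix_vecMul_equiv, Function.comp_assoc, Equiv.self_comp_symm,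
      Function.comp_id, Matrix.mul_assoc, ← Matrix.vecMul_vecMul y, hyT]
  set y₁ : Fin a → ℝ := fun i => y (e (Sum.inl i))
  set y₂ : Fin b → ℝ := fun i => y (e (Sum.inr i))
  have hsplit : y ∘ e = Sum.elim y₁ y₂ := by
    ext i; rcases i with i | i <;> rfl
  have h1 : y₁ = 0 := by
    have := key E
    rw [hTE, hsplit, Matrix.vecMul_fromBlocks, ← Matrix.vecMul_vecMul, hE,
      Matrix.zero_vecMul] at this
    have := congrArg (fun f => f ∘ Sum.inl) this
    simpa using this
  have h2 : y₂ = 0 := by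
    have hnull : ∀ j, E *ᵥ (U.col (e (Sum.inr j))) = 0 := fun j => by
      have h0 : T *ᵥ (E *ᵥ (U.col (e (Sum.inr j)))) = 0 := by
        ext i
        have := congrFun (congrFun hTE (e.symm i)) (Sum.inr j)
        rw [Matrix.submatrix_apply, Equiv.apply_symm_apply, Matrix.mul_assoc] at this
        rw [Matrix.mulVec_mulVec]
        rw [← Matrix.mul_assoc] at this
        refine Eq.trans ?_ (this.trans ?_)
        · rfl
        · rcases e.symm i with i | i <;> simp
      have h1 := congrArg (fun v => T⁻¹ *ᵥ v) h0
      simpa [Matrix.mulVec_mulVec, Matrix.nonsing_inv_mul_cancel_left _ _ hT,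
        Matrix.nonsing_inv_mul _ hT] using h1
    have := key A
    rw [hTA, hsplit, Matrix.vecMul_fromBlocks, h1] at this
    ext j
    have hj := congrFun this (Sum.inr j)
    obtain ⟨c, hc⟩ := hQ.exists_eq_mulVec (hnull j)
    have hz : (x ᵥ* (A * U)) (e (Sum.inr j)) = 0 := by
      rw [← Matrix.vecMul_vecMul]
      change (x ᵥ* A) ⬝ᵥ U.col (e (Sum.inr j)) = 0
      rw [hc, Matrix.dotProduct_mulVec, Matrix.vecMul_vecMul, hA, zero_dotProduct]
    simpa [hz] using hj
  have hy0 : y = 0 := by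
    have : (y ∘ e) ∘ e.symm = 0 := by rw [hsplit, h1, h2]; ext i; rcases e.symm i <;> simp_all
    simpa [Function.comp_assoc] using this
  rw [← hyT, hy0, Matrix.zero_vecMul]

/-- With `V` a basis of `range E`, the hypothesis makes `M = [E V, A Q]` invertible. Then `M⁻¹ E [V
Q] = [1 0; 0 0]` and `M⁻¹ A [V Q] = [C 0; X 1]`; replacing `V` by `V - Q X` clears `X` and leaves `E
V` unchanged. -/
theorem hasIndexAtMost_one_of_vecMul {n k : ℕ} {E A : Matrix (Fin n) (Fin n) ℝ} (hsymm : Eᵀ = E)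
    {Q : Matrix (Fin n) (Fin k) ℝ} (hQ : IsNullspaceMatrix E Q)
    (h : ∀ x : Fin n → ℝ, x ᵥ* E = 0 → x ᵥ* (A * Q) = 0 → x = 0) : HasIndexAtMost E A 1 := by
  obtain ⟨a, V, hV⟩ := exists_isRangeMatrix E
  have hcard : a + k = n := by
    have h1 : a = Module.finrank ℝ (LinearMap.range E.mulVecLin) := by
      have hli : LinearIndependent ℝ V.col := by
        rw [← Matrix.mulVec_injective_iff]
        intro v w hvw
        have := congrArg (fun u => Vᵀ *ᵥ u) hvw
        simpa [Matrix.mulVec_mulVec, hV.orthonormal] using this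
      rw [← hV.span_eq, finrank_span_eq_card hli, Fintype.card_fin]
    have h2 : k = Module.finrank ℝ (LinearMap.ker E.mulVecLin) := by
      have hli : LinearIndependent ℝ Q.col := by
        rw [← Matrix.mulVec_injective_iff]
        intro v w hvw
        have := congrArg (fun u => Qᵀ *ᵥ u) hvw
        simpa [Matrix.mulVec_mulVec, hQ.orthonormal] using this
      rw [← hQ.span_eq, finrank_span_eq_card hli, Fintype.card_fin]
    rw [h1, h2, LinearMap.finrank_range_add_finrank_ker, Module.finrank_fin_fun]
  let e : Fin a ⊕ Fin k ≃ Fin n := finSumFinEquiv.trans (finCongr hcard)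
  -- Symmetry of `E` makes its kernel orthogonal to its range, so `[V Q]` is an orthogonal matrix.
  have hVQ : Qᵀ * V = 0 := by
    obtain ⟨X, hX⟩ := hV.exists_eq_mul
    rw [hX, ← Matrix.mul_assoc, ← hsymm, ← Matrix.transpose_mul, hQ.mul_eq_zero]
    simp
  have hunit : ∀ W : Matrix (Fin n) (Fin a ⊕ Fin k) ℝ, (∀ x, x ᵥ* W = 0 → x = 0) →
      IsUnit (W.submatrix id e.symm).det := fun W hW => by
    rw [isUnit_iff_ne_zero, ne_eq, ← Matrix.exists_vecMul_eq_zero_iff]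
    rintro ⟨x, hx, hx'⟩
    refine hx (hW x ?_)
    ext i
    simpa [Matrix.vecMul, dotProduct] using congrFun hx' (e i)
  have hUV : ∀ x : Fin n → ℝ, x ᵥ* V = 0 → x ᵥ* Q = 0 → x = 0 := fun x h1 h2 => by
    have hone : (fromCols V Q).submatrix id e.symm * ((fromCols V Q).submatrix id e.symm)ᵀ = 1 := by
      rw [mul_eq_one_comm, Matrix.transpose_submatrix, 
        ← Matrix.submatrix_mul _ _ _ id _ Function.bijective_id, Matrix.transpose_fromCols, Matrix.fromRows_mul_fromCols, hV.orthonormal, hQ.orthonormal,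
        hVQ, show Vᵀ * Q = 0 by rw [← Matrix.transpose_transpose (Vᵀ * Q)]; simp [hVQ],
        Matrix.fromBlocks_one, Matrix.submatrix_one_equiv]
    have h0 : x ᵥ* (fromCols V Q).submatrix id e.symm = 0 := by
      ext i
      have : x ᵥ* fromCols V Q = 0 := by
        rw [Matrix.vecMul_fromCols, h1, h2, Sum.elim_zero_zero]
      exact congrFun this (e.symm i)
    rw [← Matrix.vecMul_one x, ← hone, ← Matrix.vecMul_vecMul, h0, Matrix.zero_vecMul]
  set M : Matrix (Fin n) (Fin n) ℝ := (fromCols (E * V) (A * Q)).submatrix id e.symm with hM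
  have hMdet : IsUnit M.det := by
    refine hunit _ fun x hx => ?_
    rw [Matrix.vecMul_fromCols, elim_eq_zero_iff] at hx
    refine h x (hUV _ ?_ ?_) hx.2
    · rw [Matrix.vecMul_vecMul, hx.1]
    · rw [Matrix.vecMul_vecMul, hQ.mul_eq_zero, Matrix.vecMul_zero]
  have hT : (M⁻¹).submatrix e id * fromCols (E * V) (A * Q) = 1 := by
    have := congrArg (fun W => W.submatrix e e) (Matrix.nonsing_inv_mul M hMdet)
    simp only [Matrix.submatrix_one_equiv] at this
    rw [← this, Matrix.submatrix_mul _ _ _ id _ Function.bijective_id, hM]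
    simp
  set T' := (M⁻¹).submatrix e id with hT'
  rw [Matrix.mul_fromCols, ← Matrix.fromBlocks_one] at hT
  obtain ⟨hTV, hTQ⟩ : T' * (E * V) = fromRows 1 0 ∧ T' * (A * Q) = fromRows 0 1 := by
    constructor
    · ext i j
      have := congrFun (congrFun hT i) (Sum.inl j)
      rcases i with i | i <;> simpa using this
    · ext i j
      have := congrFun (congrFun hT i) (Sum.inr j)
      rcases i with i | i <;> simpa using this
  set C : Matrix (Fin a) (Fin a) ℝ := (T' * (A * V)).toRows₁
  set X : Matrix (Fin k) (Fin a) ℝ := (T' * (A * V)).toRows₂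
  have hTAV : T' * (A * V) = fromRows C X := (Matrix.fromRows_toRows _).symm
  have hcomp : ∀ N : Matrix (Fin n) (Fin n) ℝ,
      (M⁻¹ * N * (fromCols (V - Q * X) Q).submatrix id e.symm).submatrix e e
        = fromCols (T' * (N * V) - T' * (N * Q) * X) (T' * (N * Q)) := fun N => by
    rw [Matrix.submatrix_mul _ _ _ id _ Function.bijective_id,
      Matrix.submatrix_mul _ _ _ id _ Function.bijective_id]
    simp [← hT', Matrix.mul_fromCols, Matrix.mul_sub, Matrix.mul_assoc]
  refine ⟨a, k, e, M⁻¹, (fromCols (V - Q * X) Q).submatrix id e.symm, C, 0,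
    Matrix.isUnit_nonsing_inv_det M hMdet, hunit _ fun x hx => ?_, ?_, ?_, pow_one 0⟩
  · rw [Matrix.vecMul_fromCols, elim_eq_zero_iff, Matrix.vecMul_sub, ← Matrix.vecMul_vecMul] at hx
    refine hUV x ?_ hx.2
    simpa [hx.2] using hx.1
  · rw [hcomp, hTV, hQ.mul_eq_zero]
    ext (i | i) (j | j) <;> simp
  · rw [hcomp, hTAV, hTQ, Matrix.fromRows_mul]
    ext (i | i) (j | j) <;> simp

/-! ### Real quadratic forms -/

theorem Matrix.dotProduct_transpose_mul_mul {p q : Type*} [Fintype p] [Fintype q]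
    (M : Matrix p p ℝ) (L : Matrix p q ℝ) (x : q → ℝ) :
    x ⬝ᵥ ((Lᵀ * M * L) *ᵥ x) = (L *ᵥ x) ⬝ᵥ (M *ᵥ (L *ᵥ x)) := by
  rw [← Matrix.mulVec_mulVec, ← Matrix.mulVec_mulVec, Matrix.dotProduct_mulVec,
    Matrix.vecMul_transpose]

theorem Matrix.dotProduct_mulVec_self_eq_zero_of_skew {p : Type*} [Fintype p]
    {M : Matrix p p ℝ} (hM : Mᵀ = -M) (x : p → ℝ) : x ⬝ᵥ (M *ᵥ x) = 0 := by
  have h : x ⬝ᵥ (M *ᵥ x) = -(x ⬝ᵥ (M *ᵥ x)) := by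
    conv_lhs => rw [Matrix.dotProduct_mulVec, ← Matrix.mulVec_transpose, hM, dotProduct_comm]
    rw [Matrix.neg_mulVec, dotProduct_neg]
  linarith

/-- A quadratic form is dominated by a small multiple of the Euclidean one. -/
theorem Matrix.exists_pos_mul_dotProduct_mulVec_le {p : Type*} [Fintype p] (M : Matrix p p ℝ) :
    ∃ ε : ℝ, 0 < ε ∧ ∀ x : p → ℝ, ε * (x ⬝ᵥ (M *ᵥ x)) ≤ x ⬝ᵥ x := by
  set c : ℝ := ∑ i, ∑ j, |M i j| with hc
  have hc0 : 0 ≤ c := Finset.sum_nonneg fun i _ => Finset.sum_nonneg fun j _ => abs_nonneg _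
  have hself : ∀ (x : p → ℝ) i, x i ^ 2 ≤ x ⬝ᵥ x := fun x i => by
    rw [sq]
    exact Finset.single_le_sum (f := fun i => x i * x i) (fun j _ => mul_self_nonneg _)
      (Finset.mem_univ i)
  have hle : ∀ x : p → ℝ, x ⬝ᵥ (M *ᵥ x) ≤ c * (x ⬝ᵥ x) := fun x => by
    rw [hc, Finset.sum_mul]
    refine Finset.sum_le_sum fun i _ => ?_
    rw [Matrix.mulVec, dotProduct, Finset.mul_sum, Finset.sum_mul]
    refine Finset.sum_le_sum fun j _ => ?_
    calc x i * (M i j * x j) = M i j * (x i * x j) := by ring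
      _ ≤ |M i j| * |x i * x j| := by rw [← abs_mul]; exact le_abs_self _
      _ ≤ |M i j| * (x ⬝ᵥ x) := by
        refine mul_le_mul_of_nonneg_left ?_ (abs_nonneg _)
        rw [abs_le]
        constructor <;>
          nlinarith [hself x i, hself x j, sq_nonneg (x i + x j), sq_nonneg (x i - x j)]
  -- The sum `c` of the absolute values of the entries bounds the form; the added `1` keeps the
  -- inverse positive when `c = 0`.
  refine ⟨(c + 1)⁻¹, by positivity, fun x => ?_⟩
  have hx : 0 ≤ x ⬝ᵥ x := Finset.sum_nonneg fun i _ => mul_self_nonneg _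
  rw [inv_mul_le_iff₀ (by positivity)]
  nlinarith [hle x]

/-! ### Kernel consequences of the port-Hamiltonian structure -/

namespace DescriptorSystem

variable {n m : ℕ} {sys : DescriptorSystem n m}

theorem IsPortHamiltonian.E_transpose (h : sys.IsPortHamiltonian) : sys.Eᵀ = sys.E :=
  (Matrix.conjTranspose_eq_transpose_of_trivial _).symm.trans h.E_posSemidef.isHermitian

theorem IsPortHamiltonian.skew (h : sys.IsPortHamiltonian) :
    sys.Jᵀ = -sys.J ∧ sys.Nᵀ = -sys.N := by
  have h1 := h.structure_skew
  rw [Matrix.fromBlocks_transpose, Matrix.fromBlocks_neg, Matrix.fromBlocks_inj] at h1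
  exact ⟨neg_eq_iff_eq_neg.mp h1.1.symm, neg_eq_iff_eq_neg.mp h1.2.2.2.symm⟩

theorem IsPortHamiltonian.symm (h : sys.IsPortHamiltonian) :
    sys.Rᵀ = sys.R ∧ sys.Sᵀ = sys.S := by
  have h1 : _ = _ := (Matrix.conjTranspose_eq_transpose_of_trivial _).symm.trans
    h.dissipation_posSemidef.isHermitian
  rw [Matrix.fromBlocks_transpose, Matrix.fromBlocks_inj] at h1
  exact ⟨h1.1, h1.2.2.2⟩

theorem IsPortHamiltonian.E_nonneg (h : sys.IsPortHamiltonian) (x : Fin n → ℝ) :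
    0 ≤ x ⬝ᵥ (sys.E *ᵥ x) :=
  h.E_posSemidef.dotProduct_mulVec_nonneg x

theorem IsPortHamiltonian.vecMul_E_eq_zero (h : sys.IsPortHamiltonian) {x : Fin n → ℝ}
    (hx : x ⬝ᵥ (sys.E *ᵥ x) = 0) : x ᵥ* sys.E = 0 := by
  rw [← Matrix.mulVec_transpose, h.E_transpose]
  exact (h.E_posSemidef.dotProduct_mulVec_zero_iff x).mp hx

theorem dotProduct_fromBlocks_inl (x : Fin n → ℝ) :
    Sum.elim x (0 : Fin m → ℝ) ⬝ᵥ
      (fromBlocks sys.R sys.P sys.Pᵀ sys.S *ᵥ Sum.elim x (0 : Fin m → ℝ)) = x ⬝ᵥ (sys.R *ᵥ x) := by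
  simp [Matrix.fromBlocks_mulVec]

theorem dotProduct_fromBlocks_inr (u : Fin m → ℝ) :
    Sum.elim (0 : Fin n → ℝ) u ⬝ᵥ
      (fromBlocks sys.R sys.P sys.Pᵀ sys.S *ᵥ Sum.elim (0 : Fin n → ℝ) u) = u ⬝ᵥ (sys.S *ᵥ u) := by
  simp [Matrix.fromBlocks_mulVec]

theorem IsPortHamiltonian.R_nonneg (h : sys.IsPortHamiltonian) (x : Fin n → ℝ) :
    0 ≤ x ⬝ᵥ (sys.R *ᵥ x) := by
  rw [← dotProduct_fromBlocks_inl]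
  exact h.dissipation_posSemidef.dotProduct_mulVec_nonneg _

/-- A vector on which a semidefinite form vanishes is a null vector of the whole matrix. Applied to
`(x, 0)`, this controls the off-diagonal block as well. -/
theorem IsPortHamiltonian.mulVec_of_R (h : sys.IsPortHamiltonian) {x : Fin n → ℝ}
    (hx : x ⬝ᵥ (sys.R *ᵥ x) = 0) : sys.R *ᵥ x = 0 ∧ sys.Pᵀ *ᵥ x = 0 := by
  rw [← dotProduct_fromBlocks_inl] at hx
  have := (h.dissipation_posSemidef.dotProduct_mulVec_zero_iff (Sum.elim x 0)).mp hx
  rw [Matrix.fromBlocks_mulVec, elim_eq_zero_iff, Sum.elim_comp_inl, Sum.elim_comp_inr] at this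
  simpa using this

theorem IsPortHamiltonian.mulVec_of_S (h : sys.IsPortHamiltonian) {u : Fin m → ℝ}
    (hu : u ⬝ᵥ (sys.S *ᵥ u) = 0) : sys.P *ᵥ u = 0 ∧ sys.S *ᵥ u = 0 := by
  rw [← dotProduct_fromBlocks_inr] at hu
  have := (h.dissipation_posSemidef.dotProduct_mulVec_zero_iff (Sum.elim 0 u)).mp hu
  rw [Matrix.fromBlocks_mulVec, elim_eq_zero_iff, Sum.elim_comp_inl, Sum.elim_comp_inr] at this
  simpa using this

theorem IsPortHamiltonian.P_mul_eq_zero (h : sys.IsPortHamiltonian) {k : ℕ}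
    {W : Matrix (Fin m) (Fin k) ℝ} (hW : sys.S * W = 0) : sys.P * W = 0 := by
  ext i j
  have hj : sys.S *ᵥ W.col j = 0 := funext fun i => congrFun (congrFun hW i) j
  exact congrFun (h.mulVec_of_S (u := W.col j) (by rw [hj, dotProduct_zero])).1 i

/-- The skew part `N` drops out of the diagonal entries, leaving `wᵀ S w = 0` for each column `w`.
-/
theorem IsPortHamiltonian.S_mul_eq_zero (h : sys.IsPortHamiltonian) {k : ℕ}
    {W : Matrix (Fin m) (Fin k) ℝ} (hW : Wᵀ * (sys.S + sys.N) * W = 0) : sys.S * W = 0 := by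
  ext i j
  have hj : W.col j ⬝ᵥ ((sys.S + sys.N) *ᵥ W.col j) = 0 := by
    have h1 := congrFun (congrFun hW j) j
    rw [Matrix.mul_assoc] at h1
    exact h1
  rw [Matrix.add_mulVec, dotProduct_add,
    Matrix.dotProduct_mulVec_self_eq_zero_of_skew h.skew.2, add_zero] at hj
  exact congrFun (h.mulVec_of_S hj).2 i

/-- This says `range S ⊆ range D`. With `p = D D⁺` the orthogonal projector onto `range D`, `(1 - p)
D (1 - p) = 0`, hence `S (1 - p) = 0`; transpose. -/
theorem IsPortHamiltonian.mul_moorePenrose_mul_S (h : sys.IsPortHamiltonian) :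
    (sys.S + sys.N) * moorePenrose (sys.S + sys.N) * sys.S = sys.S := by
  set D := sys.S + sys.N with hD
  have hp := moorePenrose_spec D
  set p := D * moorePenrose D with hpdef
  have h1 : sys.S * (1 - p) = 0 := by
    refine h.S_mul_eq_zero ?_
    rw [← hD, Matrix.transpose_sub, hp.symm_left, Matrix.transpose_one, Matrix.sub_mul,
      hp.mul_mul_left, Matrix.one_mul, sub_self, Matrix.zero_mul]
  have h2 := congrArg Matrix.transpose h1
  rw [Matrix.transpose_mul, Matrix.transpose_sub, hp.symm_left, h.symm.2, Matrix.transpose_one,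
    Matrix.transpose_zero, Matrix.sub_mul, Matrix.one_mul, sub_eq_zero] at h2
  exact h2.symm

/-! ### Structure-preserving feedbacks -/

/-- A feedback that preserves the port-Hamiltonian structure acts only through the two admissible
input matrices. -/
theorem IsPortHamiltonian.exists_feedback_factorization (h : sys.IsPortHamiltonian)
    {F : Matrix (Fin m) (Fin n) ℝ} (hF : (sys.closedLoop F).IsPortHamiltonian) {k₂ k₃ : ℕ}
    {Q : Matrix (Fin m) (Fin k₂) ℝ} (hQ : IsRangeMatrix sys.S Q)
    {Q' : Matrix (Fin m) (Fin k₃) ℝ} (hQ' : IsNullspaceMatrix (sys.S + sys.N) Q') :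
    ∃ (F₁ : Matrix (Fin k₂) (Fin n) ℝ) (F₃ : Matrix (Fin k₃) (Fin n) ℝ),
      F = moorePenrose (sys.S + sys.N) * Q * F₁ + Q' * F₃ := by
  set D := sys.S + sys.N with hD
  have hp := moorePenrose_spec D
  have hS : sys.S * (1 - Q * Qᵀ) = 0 := by
    have h2 := congrArg Matrix.transpose hQ.mul_transpose_mul
    rw [Matrix.transpose_mul, Matrix.transpose_mul, Matrix.transpose_transpose, h.symm.2] at h2
    rw [Matrix.mul_sub, Matrix.mul_one, h2, sub_self]
  have hP := h.P_mul_eq_zero hS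
  -- The closed loop has the same `S`, so its own `P` vanishes on `ker S` too; the difference of the
  -- two is half of `(D F)ᵀ`.
  have hP' : (sys.P + (1 / 2 : ℝ) • (Fᵀ * Dᵀ)) * (1 - Q * Qᵀ) = 0 := hF.P_mul_eq_zero hS
  have hDF : D * F = Q * (Qᵀ * (D * F)) := by
    rw [Matrix.add_mul, hP, zero_add, Matrix.smul_mul, smul_eq_zero_iff_right (by norm_num)] at hP'
    have h2 := congrArg Matrix.transpose hP'
    rw [← Matrix.transpose_mul, Matrix.transpose_mul, Matrix.transpose_transpose,
      Matrix.transpose_sub, Matrix.transpose_mul, Matrix.transpose_transpose,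
      Matrix.transpose_one, Matrix.transpose_zero, Matrix.sub_mul, Matrix.one_mul,
      sub_eq_zero] at h2
    rw [← Matrix.mul_assoc, ← h2]
  obtain ⟨F₃, hF₃⟩ := hQ'.exists_eq_mul (W := F - moorePenrose D * (D * F)) (by
    rw [Matrix.mul_sub, ← Matrix.mul_assoc, ← Matrix.mul_assoc, hp.mul_mul_left, sub_self])
  refine ⟨Qᵀ * (D * F), F₃, ?_⟩
  rw [← hF₃, Matrix.mul_assoc _ Q, ← hDF, add_sub_cancel]

/-- A feedback that preserves the port-Hamiltonian structure and dissipates along all directions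
that are seen by the two admissible input matrices. -/
theorem IsPortHamiltonian.exists_dissipative_feedback (h : sys.IsPortHamiltonian) {k₂ k₃ : ℕ}
    {Q : Matrix (Fin m) (Fin k₂) ℝ} (hQ : IsRangeMatrix sys.S Q)
    {Q' : Matrix (Fin m) (Fin k₃) ℝ} (hQ' : IsNullspaceMatrix (sys.S + sys.N) Q') :
    ∃ F : Matrix (Fin m) (Fin n) ℝ, (sys.closedLoop F).IsPortHamiltonian ∧
      ∀ x : Fin n → ℝ, x ⬝ᵥ ((sys.closedLoop F).R *ᵥ x) = 0 →
        x ᵥ* ((sys.G - sys.P) * moorePenrose (sys.S + sys.N) * Q) = 0 ∧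
        x ᵥ* ((sys.G - sys.P) * Q') = 0 := by
  set D := sys.S + sys.N with hD
  set B := sys.G - sys.P with hB
  set K := moorePenrose D with hK
  obtain ⟨hRt, hSt⟩ := h.symm
  obtain ⟨hJt, hNt⟩ := h.skew
  have hDQ' : D * Q' = 0 := hQ'.mul_eq_zero
  have hSQ' : sys.S * Q' = 0 := h.S_mul_eq_zero (by rw [Matrix.mul_assoc, hDQ', Matrix.mul_zero])
  have hPQ' : sys.P * Q' = 0 := h.P_mul_eq_zero hSQ'
  have hDKS : D * (K * sys.S) = sys.S := by
    rw [← Matrix.mul_assoc]; exact h.mul_moorePenrose_mul_S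
  obtain ⟨ε, hε, hSε⟩ := sys.S.exists_pos_mul_dotProduct_mulVec_le
  -- `Yᵀ` is the input matrix `B D⁺ S` shifted by `P`, so that `B D⁺ S Y = YᵀY - P Y`: a square plus
  -- a cross term that the congruence below absorbs.
  set Y : Matrix (Fin m) (Fin n) ℝ := sys.Pᵀ + (B * K * sys.S)ᵀ with hY
  have hYt : Yᵀ = sys.P + B * K * sys.S := by
    rw [hY, Matrix.transpose_add, Matrix.transpose_transpose, Matrix.transpose_transpose]
  set F₃ : Matrix (Fin m) (Fin n) ℝ := Q' * (B * Q')ᵀ with hF₃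
  have hDF₃ : D * F₃ = 0 := by rw [hF₃, ← Matrix.mul_assoc, hDQ', Matrix.zero_mul]
  have hSF₃ : sys.S * F₃ = 0 := by rw [hF₃, ← Matrix.mul_assoc, hSQ', Matrix.zero_mul]
  have hPF₃ : sys.P * F₃ = 0 := by rw [hF₃, ← Matrix.mul_assoc, hPQ', Matrix.zero_mul]
  have hBF₃ : B * F₃ = B * Q' * (B * Q')ᵀ := by rw [hF₃, Matrix.mul_assoc]
  set F : Matrix (Fin m) (Fin n) ℝ := -(ε • (K * sys.S * Y)) - F₃ with hF
  -- `H` is chosen so that the new `P` equals `P + Hᵀ S`, as under congruence by `[1 0; H 1]`; `W`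
  -- is what remains of `R̃`.
  set H : Matrix (Fin m) (Fin n) ℝ := -((ε / 2) • Y) - F₃ with hH
  set W : Matrix (Fin n) (Fin n) ℝ :=
    B * Q' * (B * Q')ᵀ + (ε • (Yᵀ * Y) - (ε ^ 2 / 4) • (Yᵀ * sys.S * Y)) with hW
  have hDF : D * F = -(ε • (sys.S * Y)) := by
    rw [hF, Matrix.mul_sub, hDF₃, sub_zero, Matrix.mul_neg, Matrix.mul_smul, ← Matrix.mul_assoc,
      hDKS]
  have hSH : sys.S * H = -((ε / 2) • (sys.S * Y)) := by
    rw [hH, Matrix.mul_sub, hSF₃, sub_zero, Matrix.mul_neg, Matrix.mul_smul]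
  have hPH : sys.P * H = -((ε / 2) • (sys.P * Y)) := by
    rw [hH, Matrix.mul_sub, hPF₃, sub_zero, Matrix.mul_neg, Matrix.mul_smul]
  have hHSH : Hᵀ * (sys.S * H) = (ε ^ 2 / 4) • (Yᵀ * sys.S * Y) := by
    have h1 : F₃ᵀ * sys.S = 0 := by
      rw [← hSt, ← Matrix.transpose_mul, hSF₃, Matrix.transpose_zero]
    rw [hSH, hH, Matrix.transpose_sub, Matrix.mul_neg, Matrix.mul_smul, Matrix.sub_mul,
      ← Matrix.mul_assoc F₃ᵀ, h1, Matrix.zero_mul, sub_zero, Matrix.transpose_neg,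
      Matrix.transpose_smul, Matrix.neg_mul, Matrix.smul_mul, smul_neg, neg_neg, smul_smul,
      ← Matrix.mul_assoc]
    congr 1; ring
  have hBF : B * F = -(ε • (B * K * sys.S * Y)) - B * Q' * (B * Q')ᵀ := by
    rw [hF, Matrix.mul_sub, hBF₃, Matrix.mul_neg, Matrix.mul_smul, ← Matrix.mul_assoc,
      ← Matrix.mul_assoc]
  have hsum : B * K * sys.S * Y = Yᵀ * Y - sys.P * Y := by
    rw [hYt, Matrix.add_mul, add_sub_cancel_left]
  have hWt : (B * Q' * (B * Q')ᵀ)ᵀ = B * Q' * (B * Q')ᵀ := by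
    rw [Matrix.transpose_mul, Matrix.transpose_transpose]
  have hR' : (sys.closedLoop F).R = sys.R + sys.P * H + (sys.P * H)ᵀ + Hᵀ * (sys.S * H) + W := by
    have h1 : (sys.closedLoop F).R = sys.R - (1 / 2 : ℝ) • (B * F + (B * F)ᵀ) := by
      rw [Matrix.transpose_mul]; rfl
    rw [h1, hBF, hsum, hPH, hHSH, hW]
    simp only [Matrix.transpose_sub, Matrix.transpose_neg, Matrix.transpose_smul, hWt,
      Matrix.transpose_mul Yᵀ Y, Matrix.transpose_transpose]
    module
  have hP' : (sys.closedLoop F).P = sys.P + Hᵀ * sys.S := by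
    have h1 : (sys.closedLoop F).P = sys.P + (1 / 2 : ℝ) • (D * F)ᵀ := by
      rw [Matrix.transpose_mul]; rfl
    have h2 : Hᵀ * sys.S = (sys.S * H)ᵀ := by rw [Matrix.transpose_mul, hSt]
    rw [h1, h2, hDF, hSH]
    simp only [Matrix.transpose_neg, Matrix.transpose_smul]
    module
  have hblock : fromBlocks (sys.closedLoop F).R (sys.closedLoop F).P (sys.closedLoop F).Pᵀ sys.S =
      (fromBlocks 1 0 H 1)ᵀ * fromBlocks sys.R sys.P sys.Pᵀ sys.S * fromBlocks 1 0 H 1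
        + fromBlocks W 0 0 0 := by
    rw [hR', hP', Matrix.fromBlocks_transpose, Matrix.fromBlocks_multiply,
      Matrix.fromBlocks_multiply, Matrix.fromBlocks_add, Matrix.fromBlocks_inj]
    simp only [Matrix.transpose_one, Matrix.transpose_zero, Matrix.one_mul, Matrix.mul_one,
      Matrix.mul_zero, Matrix.zero_mul, zero_add, add_zero, Matrix.transpose_add,
      Matrix.transpose_mul, Matrix.transpose_transpose, hSt, and_true, Matrix.add_mul, Matrix.mul_assoc]
    abel
  have hWx : ∀ x : Fin n → ℝ, x ⬝ᵥ (W *ᵥ x) = ((B * Q')ᵀ *ᵥ x) ⬝ᵥ ((B * Q')ᵀ *ᵥ x)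
      + (ε * ((Y *ᵥ x) ⬝ᵥ (Y *ᵥ x)) - ε ^ 2 / 4 * ((Y *ᵥ x) ⬝ᵥ (sys.S *ᵥ (Y *ᵥ x)))) := fun x => by
    have h1 := Matrix.dotProduct_transpose_mul_mul 1 ((B * Q')ᵀ) x
    have h2 := Matrix.dotProduct_transpose_mul_mul 1 Y x
    have h3 := Matrix.dotProduct_transpose_mul_mul sys.S Y x
    rw [Matrix.mul_one, Matrix.one_mulVec] at h1 h2
    rw [Matrix.transpose_transpose] at h1
    rw [hW, Matrix.add_mulVec, Matrix.sub_mulVec, Matrix.smul_mulVec, Matrix.smul_mulVec,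
      dotProduct_add, dotProduct_sub, dotProduct_smul, dotProduct_smul, h1, h2, h3, smul_eq_mul,
      smul_eq_mul]
  -- Since `ε S ≤ 1`, the negative term of `W` costs at most `ε / 4` of the square `YᵀY`.
  have hWlower : ∀ x : Fin n → ℝ, ((B * Q')ᵀ *ᵥ x) ⬝ᵥ ((B * Q')ᵀ *ᵥ x)
      + ε / 2 * ((Y *ᵥ x) ⬝ᵥ (Y *ᵥ x)) ≤ x ⬝ᵥ (W *ᵥ x) := fun x => by
    have h0 : 0 ≤ (Y *ᵥ x) ⬝ᵥ (Y *ᵥ x) := Finset.sum_nonneg fun i _ => mul_self_nonneg _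
    rw [hWx]
    nlinarith [mul_le_mul_of_nonneg_left (hSε (Y *ᵥ x)) hε.le, mul_nonneg hε.le h0]
  have hnonneg : ∀ {k : ℕ} (z : Fin k → ℝ), 0 ≤ z ⬝ᵥ z :=
    fun z => Finset.sum_nonneg fun i _ => mul_self_nonneg _
  have hform : ∀ v : Fin n ⊕ Fin m → ℝ,
      v ⬝ᵥ (fromBlocks (sys.closedLoop F).R (sys.closedLoop F).P (sys.closedLoop F).Pᵀ sys.S *ᵥ v)
        = (fromBlocks 1 0 H 1 *ᵥ v) ⬝ᵥ (fromBlocks sys.R sys.P sys.Pᵀ sys.S *ᵥ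
            (fromBlocks 1 0 H 1 *ᵥ v)) + (v ∘ Sum.inl) ⬝ᵥ (W *ᵥ (v ∘ Sum.inl)) := fun v => by
    rw [hblock, Matrix.add_mulVec, dotProduct_add, Matrix.dotProduct_transpose_mul_mul]
    congr 1
    obtain ⟨x, u, rfl⟩ : ∃ x u, v = Sum.elim x u := ⟨_, _, (Sum.elim_comp_inl_inr v).symm⟩
    simp [Matrix.fromBlocks_mulVec]
  have hWnonneg : ∀ x : Fin n → ℝ, 0 ≤ x ⬝ᵥ (W *ᵥ x) := fun x =>
    le_trans (add_nonneg (hnonneg _) (mul_nonneg (by positivity) (hnonneg _))) (hWlower x)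
  have hRt' : (sys.closedLoop F).Rᵀ = (sys.closedLoop F).R := by
    have h1 : (sys.closedLoop F).R = sys.R - (1 / 2 : ℝ) • (B * F + (B * F)ᵀ) := by
      rw [Matrix.transpose_mul]; rfl
    rw [h1, Matrix.transpose_sub, hRt, Matrix.transpose_smul, Matrix.transpose_add,
      Matrix.transpose_transpose, add_comm (B * F)]
  refine ⟨F, ⟨h.E_posSemidef, ?_, ?_⟩, fun x hx => ?_⟩
  · rw [Matrix.fromBlocks_transpose, Matrix.fromBlocks_neg, Matrix.fromBlocks_inj]
    refine ⟨?_, ?_, rfl, ?_⟩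
    · have h1 : (sys.closedLoop F).J = sys.J + (1 / 2 : ℝ) • (B * F - (B * F)ᵀ) := by
        rw [Matrix.transpose_mul]; rfl
      rw [h1, Matrix.transpose_add, hJt, Matrix.transpose_smul, Matrix.transpose_sub,
        Matrix.transpose_transpose]
      module
    · rw [Matrix.transpose_neg, Matrix.transpose_transpose, neg_neg]
    · change sys.N = -sys.Nᵀ
      rw [hNt, neg_neg]
  · refine Matrix.PosSemidef.of_dotProduct_mulVec_nonneg ?_ fun v => ?_
    · rw [Matrix.IsHermitian, Matrix.conjTranspose_eq_transpose_of_trivial,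
        Matrix.fromBlocks_transpose, Matrix.transpose_transpose, hRt']
      exact congrArg _ hSt
    · refine le_of_le_of_eq ?_ (hform v).symm
      exact add_nonneg (h.dissipation_posSemidef.dotProduct_mulVec_nonneg _) (hWnonneg _)
  · have h1 := hform (Sum.elim x 0)
    have h2 : Sum.elim x (0 : Fin m → ℝ) ⬝ᵥ (fromBlocks (sys.closedLoop F).R (sys.closedLoop F).P
        (sys.closedLoop F).Pᵀ sys.S *ᵥ Sum.elim x 0) = x ⬝ᵥ ((sys.closedLoop F).R *ᵥ x) :=
      dotProduct_fromBlocks_inl (sys := sys.closedLoop F) x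
    rw [h2, hx, Sum.elim_comp_inl] at h1
    have h3 := h.dissipation_posSemidef.dotProduct_mulVec_nonneg
      (fromBlocks 1 0 H 1 *ᵥ Sum.elim x (0 : Fin m → ℝ))
    rw [star_trivial] at h3
    have h4 := hWlower x
    have h5 := hnonneg ((B * Q')ᵀ *ᵥ x)
    have h6 := mul_nonneg (half_pos hε).le (hnonneg (Y *ᵥ x))
    have hq : (B * Q')ᵀ *ᵥ x = 0 := dotProduct_self_eq_zero.mp (by linarith)
    have hy : Y *ᵥ x = 0 := by
      refine dotProduct_self_eq_zero.mp ?_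
      have : ε / 2 * ((Y *ᵥ x) ⬝ᵥ (Y *ᵥ x)) = 0 := by linarith
      exact (mul_eq_zero.mp this).resolve_left (half_pos hε).ne'
    have hHx : H *ᵥ x = 0 := by
      rw [hH, Matrix.sub_mulVec, Matrix.neg_mulVec, Matrix.smul_mulVec, hy, hF₃,
        ← Matrix.mulVec_mulVec, hq]
      simp
    -- With `H x = 0` the congruence fixes `(x, 0)`, so the original dissipation vanishes there.
    -- Then `Pᵀ x = 0`, and `Y x = 0` reduces to `x` killing `B D⁺ S`.
    have hRx : x ⬝ᵥ (sys.R *ᵥ x) = 0 := by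
      have h7 : fromBlocks 1 0 H 1 *ᵥ Sum.elim x (0 : Fin m → ℝ) = Sum.elim x 0 := by
        simp [Matrix.fromBlocks_mulVec, hHx]
      rw [h7, dotProduct_fromBlocks_inl] at h1 h3
      linarith [hWnonneg x]
    have hPx := (h.mulVec_of_R hRx).2
    refine ⟨?_, by rwa [Matrix.mulVec_transpose] at hq⟩
    rw [hY, Matrix.add_mulVec, hPx, zero_add, Matrix.mulVec_transpose] at hy
    obtain ⟨X, hX⟩ := hQ.exists_eq_mul
    rw [hX, ← Matrix.mul_assoc, ← Matrix.vecMul_vecMul, hy, Matrix.zero_vecMul]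

/-! ### Energy balance for the pencil -/

theorem closedLoop_J_sub_R (F : Matrix (Fin m) (Fin n) ℝ) :
    (sys.closedLoop F).J - (sys.closedLoop F).R = sys.J - sys.R + (sys.G - sys.P) * F := by
  simp only [closedLoop]
  module

theorem IsPortHamiltonian.dotProduct_vecMul (h : sys.IsPortHamiltonian) (x : Fin n → ℝ) :
    (x ᵥ* (sys.J - sys.R)) ⬝ᵥ x = -(x ⬝ᵥ (sys.R *ᵥ x)) := by
  rw [← Matrix.dotProduct_mulVec, Matrix.sub_mulVec, dotProduct_sub,
    Matrix.dotProduct_mulVec_self_eq_zero_of_skew h.skew.1, zero_sub]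

/-- A left eigenvector of a port-Hamiltonian pencil in the closed right half plane does not
dissipate, and it is annihilated by `E` in the open right half plane. -/
theorem IsPortHamiltonian.eq_zero_of_vecMul_pencil (h : sys.IsPortHamiltonian) {s : ℂ}
    (hs : 0 ≤ s.re) {x : Fin n → ℂ} (hx : x ᵥ* pencil sys.E (sys.J - sys.R) s = 0) :
    ((fun i => (x i).re) ⬝ᵥ (sys.R *ᵥ fun i => (x i).re) = 0 ∧
      (fun i => (x i).im) ⬝ᵥ (sys.R *ᵥ fun i => (x i).im) = 0) ∧
    (0 < s.re → (fun i => (x i).re) ᵥ* sys.E = 0 ∧ (fun i => (x i).im) ᵥ* sys.E = 0) := by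
  rw [vecMul_pencil_eq_zero_iff] at hx
  set a : Fin n → ℝ := fun i => (x i).re
  set b : Fin n → ℝ := fun i => (x i).im
  have h1 := congrArg (· ⬝ᵥ a) hx.1
  have h2 := congrArg (· ⬝ᵥ b) hx.2
  simp only [sub_dotProduct, add_dotProduct, smul_dotProduct, smul_eq_mul, h.dotProduct_vecMul]
    at h1 h2
  -- By symmetry of `E` the terms with `s.im` cancel when the two balances are added, leaving
  -- nonnegative quantities that sum to zero.
  have hab : (a ᵥ* sys.E) ⬝ᵥ b = (b ᵥ* sys.E) ⬝ᵥ a := by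
    rw [← Matrix.dotProduct_mulVec, dotProduct_comm, ← Matrix.vecMul_transpose, h.E_transpose]
  rw [← Matrix.dotProduct_mulVec a] at h1
  rw [← Matrix.dotProduct_mulVec b, hab] at h2
  have ha := h.R_nonneg a
  have hb := h.R_nonneg b
  have hEa := h.E_nonneg a
  have hEb := h.E_nonneg b
  have hsa := mul_nonneg hs hEa
  have hsb := mul_nonneg hs hEb
  refine ⟨⟨by linarith, by linarith⟩, fun hpos => ⟨?_, ?_⟩⟩
  · exact h.vecMul_E_eq_zero
      ((mul_eq_zero.mp (show s.re * (a ⬝ᵥ (sys.E *ᵥ a)) = 0 by linarith)).resolve_left hpos.ne')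
  · exact h.vecMul_E_eq_zero
      ((mul_eq_zero.mp (show s.re * (b ⬝ᵥ (sys.E *ᵥ b)) = 0 by linarith)).resolve_left hpos.ne')

end DescriptorSystem

/-! ### The equivalence -/

theorem theorem3p1 {n m : ℕ} (sys : DescriptorSystem n m) (hsys : sys.IsPortHamiltonian)
    {k₁ k₂ k₃ : ℕ}
    (nullE : Matrix (Fin n) (Fin k₁) ℝ) (h_nullE : IsNullspaceMatrix sys.E nullE)
    (rangeS : Matrix (Fin m) (Fin k₂) ℝ) (h_rangeS : IsRangeMatrix sys.S rangeS)
    (nullD : Matrix (Fin m) (Fin k₃) ℝ) (h_nullD : IsNullspaceMatrix (sys.S + sys.N) nullD) :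
    (∃ F : Matrix (Fin m) (Fin n) ℝ,
      (sys.closedLoop F).IsPortHamiltonian ∧
      IsRegularPencil sys.E ((sys.closedLoop F).J - (sys.closedLoop F).R) ∧
      HasIndexAtMost sys.E ((sys.closedLoop F).J - (sys.closedLoop F).R) 1 ∧
      ∀ s : ℂ, IsFiniteEigenvalue sys.E ((sys.closedLoop F).J - (sys.closedLoop F).R) s →
        s.re < 0) ↔
    ((∀ s : ℂ, s.re = 0 →
        (fromCols (pencil sys.E (sys.J - sys.R) s)
          (fromCols
            (complexify ((sys.G - sys.P) * moorePenrose (sys.S + sys.N) * rangeS))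
            (complexify ((sys.G - sys.P) * nullD)))).rank = n) ∧
      (fromCols sys.E
        (fromCols ((sys.J - sys.R) * nullE)
          (fromCols ((sys.G - sys.P) * moorePenrose (sys.S + sys.N) * rangeS)
            ((sys.G - sys.P) * nullD)))).rank = n) := by
  simp only [rank_eq_iff_forall_vecMul, Matrix.vecMul_fromCols, elim_eq_zero_iff]
  -- Left vectors that kill both input matrices cannot distinguish the open loop from the closed
  -- loop.
  have hfactor : ∀ {F : Matrix (Fin m) (Fin n) ℝ}, (sys.closedLoop F).IsPortHamiltonian →
      ∀ {x : Fin n → ℝ},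
        x ᵥ* ((sys.G - sys.P) * moorePenrose (sys.S + sys.N) * rangeS) = 0 →
        x ᵥ* ((sys.G - sys.P) * nullD) = 0 → x ᵥ* ((sys.G - sys.P) * F) = 0 := by
    intro F hF x h1 h3
    obtain ⟨F₁, F₃, rfl⟩ := hsys.exists_feedback_factorization hF h_rangeS h_nullD
    rw [Matrix.mul_add, ← Matrix.mul_assoc, ← Matrix.mul_assoc, ← Matrix.mul_assoc,
      Matrix.vecMul_add, ← Matrix.vecMul_vecMul, h1, ← Matrix.vecMul_vecMul, h3,
      Matrix.zero_vecMul, Matrix.zero_vecMul, add_zero]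
  constructor
  · rintro ⟨F, hF, -, hindex, hstable⟩
    rw [DescriptorSystem.closedLoop_J_sub_R] at hindex hstable
    refine ⟨fun s hs x hx => ?_, fun x hx => ?_⟩
    · refine (det_pencil_ne_zero_iff _ _ _).mp
        (fun hdet => (hstable s hdet).ne hs) x ?_
      obtain ⟨hx0, hx1, hx3⟩ := hx
      rw [vecMul_complexify_eq_zero_iff] at hx1 hx3
      rw [pencil_add, Matrix.vecMul_sub, hx0, (vecMul_complexify_eq_zero_iff _ _).mpr
        ⟨hfactor hF hx1.1 hx3.1, hfactor hF hx1.2 hx3.2⟩, sub_zero]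
    · obtain ⟨hxE, hxA, hx1, hx3⟩ := hx
      refine hindex.eq_zero_of_vecMul h_nullE hxE ?_
      rw [Matrix.add_mul, Matrix.vecMul_add, hxA, ← Matrix.vecMul_vecMul, hfactor hF hx1 hx3,
        Matrix.zero_vecMul, add_zero]
  · rintro ⟨himag, hinf⟩
    obtain ⟨F, hF, hdiss⟩ := hsys.exists_dissipative_feedback h_rangeS h_nullD
    have hopen : ∀ {x : Fin n → ℝ}, x ᵥ* sys.E = 0 → x ⬝ᵥ ((sys.closedLoop F).R *ᵥ x) = 0 →
        x ᵥ* (((sys.closedLoop F).J - (sys.closedLoop F).R) * nullE) = 0 → x = 0 := by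
      intro x hE hR hA
      obtain ⟨h1, h3⟩ := hdiss x hR
      refine hinf x ⟨hE, ?_, h1, h3⟩
      rwa [DescriptorSystem.closedLoop_J_sub_R, Matrix.add_mul, Matrix.vecMul_add,
        ← Matrix.vecMul_vecMul x (_ * F), hfactor hF h1 h3, Matrix.zero_vecMul, add_zero] at hA
    have hdet : ∀ s : ℂ, 0 ≤ s.re →
        (pencil sys.E ((sys.closedLoop F).J - (sys.closedLoop F).R) s).det ≠ 0 := by
      intro s hs
      rw [det_pencil_ne_zero_iff]
      intro x hx
      obtain ⟨⟨hRa, hRb⟩, hpos⟩ := hF.eq_zero_of_vecMul_pencil hs hx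
      rcases hs.eq_or_lt with hs0 | hs0
      · obtain ⟨ha1, ha3⟩ := hdiss _ hRa
        obtain ⟨hb1, hb3⟩ := hdiss _ hRb
        rw [DescriptorSystem.closedLoop_J_sub_R, pencil_add, Matrix.vecMul_sub,
          (vecMul_complexify_eq_zero_iff ((sys.G - sys.P) * F) x).mpr
            ⟨hfactor hF ha1 ha3, hfactor hF hb1 hb3⟩, sub_zero] at hx
        exact himag s hs0.symm x ⟨hx, (vecMul_complexify_eq_zero_iff _ _).mpr ⟨ha1, hb1⟩,
          (vecMul_complexify_eq_zero_iff _ _).mpr ⟨ha3, hb3⟩⟩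
      · have hEa : (fun i => (x i).re) ᵥ* sys.E = 0 := (hpos hs0).1
        have hEb : (fun i => (x i).im) ᵥ* sys.E = 0 := (hpos hs0).2
        have hx' := (vecMul_pencil_eq_zero_iff _ _ _ _).mp hx
        rw [hEa, hEb] at hx'
        simp only [smul_zero, sub_zero, add_zero] at hx'
        have ha := hopen hEa hRa (by rw [← Matrix.vecMul_vecMul, ← hx'.1, Matrix.zero_vecMul])
        have hb := hopen hEb hRb (by rw [← Matrix.vecMul_vecMul, ← hx'.2, Matrix.zero_vecMul])
        exact funext fun i => Complex.ext (congrFun ha i) (congrFun hb i)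
    refine ⟨F, hF, ⟨0, hdet 0 le_rfl⟩, ?_, fun s hs => ?_⟩
    · refine hasIndexAtMost_one_of_vecMul hsys.E_transpose h_nullE fun x hE hA => ?_
      refine hopen hE ?_ hA
      -- As `E` is symmetric, `x` itself lies in `ker E`. So `x (A Q) = 0` gives `xᵀ A x = 0`, which
      -- is zero dissipation.
      obtain ⟨c, hc⟩ := h_nullE.exists_eq_mulVec (x := x) (by
        rw [← hsys.E_transpose, Matrix.mulVec_transpose, hE])
      have h1 := hF.dotProduct_vecMul x
      rw [← neg_eq_zero, ← h1]
      conv_lhs => rw [hc, Matrix.dotProduct_mulVec, ← hc, Matrix.vecMul_vecMul, hA, zero_dotProduct]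
    · by_contra hcon
      exact hdet s (not_lt.mp hcon) hs
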